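/- All groups are finite and all characters are complex; write $\langle\varphi,\psi\rangle=\frac1{|N|}\sum_{n\in N}\varphi(n)\overline{\psi(n)}$ for complex functions on a finite group $N$. A finite group $E$ is called pseudo-unramified over a nontrivial abelian normal subgroup $N$ if for every linear (degree $1$) character $\mu$ of $N$ there is an irreducible character $\chi$ of $E$ such that $\langle\chi|_N,\mu\rangle>0$ and $\chi|_N$ is multiplicity free, i.e. $\langle\chi|_N,\nu\rangle\le 1$ for every irreducible character $\nu$ of $N$. A finite group $E$ is called totally pseudo-unramified if it is abelian, or (recursively) if it has a nontrivial abelian normal subgroup $N$ such that $E$ is pseudo-unramified over $N$ and $E/N$ is totally pseudo-unramified. Let $A$ be a finite abelian group, let $G$ be a finite totally pseudo-unramified group, and let $A\rtimes G$ be the semidirect product (with $A$ normal) for an arbitrary action of $G$ on $A$ by automorphisms. Then $A\rtimes G$ is totally pseudo-unramified. Moreover, if $A$ is nontrivial, then $A\rtimes G$ is pseudo-unramified over $A$. -/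

import Mathlib

universe u

open scoped ComplexOrder ComplexConjugate

namespace PseudoUnramified

/-- The set of irreducible complex characters of `G`. Every finite-dimensional complex
representation is equivalent to one on some `Fin n → ℂ`, so these spaces suffice. -/
def Irr (G : Type*) [Group G] : Set (G → ℂ) :=
  {χ | ∃ (n : ℕ) (ρ : Representation ℂ G (Fin n → ℂ)), ρ.IsIrreducible ∧ χ = ρ.character}

/-- The set of linear complex characters of `G`, i.e. the irreducible characters of degree `1`. -/
def Lin (G : Type*) [Group G] : Set (G → ℂ) :=
  {χ | χ ∈ Irr G ∧ χ 1 = 1}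

/-- The scalar product `⟨φ, ψ⟩ = |G|⁻¹ ∑ g, φ g * conj (ψ g)` of complex functions on a
finite group. -/
noncomputable def scalarProduct {G : Type*} (φ ψ : G → ℂ) : ℂ :=
  (Nat.card G : ℂ)⁻¹ * ∑ᶠ g : G, φ g * conj (ψ g)

/-- A character is multiplicity free if `⟨χ, μ⟩ ≤ 1` for every irreducible character `μ`.
(The order on `ℂ` is the usual partial one: `z ≤ w` iff `w - z` is a nonnegative real.) -/
def IsMultiplicityFree {G : Type*} [Group G] (χ : G → ℂ) : Prop :=
  ∀ μ ∈ Irr G, scalarProduct χ μ ≤ 1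

/-- The restriction to a subgroup `N` of a function on `G`. -/
def restrict {G : Type*} [Group G] (N : Subgroup G) (χ : G → ℂ) : N → ℂ :=
  fun n => χ n

/-- The irreducible characters of `G` lying over the character `μ` of the subgroup `N`. -/
def IrrOver {G : Type*} [Group G] (N : Subgroup G) (μ : N → ℂ) : Set (G → ℂ) :=
  {χ | χ ∈ Irr G ∧ 0 < scalarProduct (restrict N χ) μ}

/-- `G` is a finite group, `N` is a nontrivial abelian normal subgroup of `G`, and `G` is
pseudo-unramified over `N`. -/
structure IsPseudoUnramifiedOver {G : Type*} [Group G] (N : Subgroup G) : Prop where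
  finite : Finite G
  normal : N.Normal
  nontrivial : N ≠ ⊥
  abelian : ∀ a ∈ N, ∀ b ∈ N, a * b = b * a
  exists_multiplicityFree : ∀ μ ∈ Lin N, ∃ χ ∈ IrrOver N μ, IsMultiplicityFree (restrict N χ)

/-- Totally pseudo-unramified finite groups. -/
inductive IsTotallyPseudoUnramified : (G : Type u) → [Group G] → Prop
  | of_abelian (G : Type u) [Group G] [Finite G] (h : ∀ a b : G, a * b = b * a) :
      IsTotallyPseudoUnramified G
  | of_quotient (G : Type u) [Group G] (N : Subgroup G) [N.Normal]
      (hN : IsPseudoUnramifiedOver N) (hQ : IsTotallyPseudoUnramified (G ⧸ N)) :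
      IsTotallyPseudoUnramified G

end PseudoUnramified

/-! For a linear character `θ` of `A`, let `G` permute its orbit and let `A ⋊ G` act monomially on
functions on that orbit. The characters in the orbit are distinct, so averaging over `A` isolates
coordinates, and transitivity moves one coordinate to any other: the representation is irreducible.
Its restriction to `A` is the orbit sum, which contains `θ` and has all multiplicities one. Thus `A
⋊ G` is pseudo-unramified over a nontrivial `A`, and the quotient by `A` is a copy of `G`, which
closes the recursion. -/

namespace PseudoUnramified

/-! ### Irreducibility via invariant subspaces -/

section Irreducibility

variable {G H : Type*} [Group G] [Group H]

/-- A nontrivial representation is irreducible as soon as every invariant subspace containing a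
nonzero vector is everything. -/
theorem isIrreducible_of_forall {V : Type*} [AddCommGroup V] [Module ℂ V] [Nontrivial V]
    (ρ : Representation ℂ G V)
    (h : ∀ W : Submodule ℂ V, (∀ g, ∀ v ∈ W, ρ g v ∈ W) → ∀ v ∈ W, v ≠ 0 → W = ⊤) :
    ρ.IsIrreducible where
  exists_pair_ne := by
    refine ⟨⊥, ⊤, fun hbt => ?_⟩
    have : (⊥ : Submodule ℂ V) = ⊤ := congrArg Subrepresentation.toSubmodule hbt
    exact bot_ne_top this
  eq_bot_or_eq_top W := by
    by_cases hW : ∃ v ∈ W.toSubmodule, v ≠ 0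
    · obtain ⟨v, hv, hv0⟩ := hW
      right
      exact Subrepresentation.toSubmodule_injective
        (h W.toSubmodule (fun g v hv => W.apply_mem_toSubmodule g hv) v hv hv0)
    · left
      push Not at hW
      exact Subrepresentation.toSubmodule_injective ((Submodule.eq_bot_iff _).2 hW)

theorem eq_top_of_isIrreducible {V : Type*} [AddCommGroup V] [Module ℂ V]
    {ρ : Representation ℂ G V} (hρ : ρ.IsIrreducible) (W : Submodule ℂ V)
    (hW : ∀ g, ∀ v ∈ W, ρ g v ∈ W) {v : V} (hv : v ∈ W) (hv0 : v ≠ 0) : W = ⊤ := by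
  rcases hρ.eq_bot_or_eq_top ⟨W, fun g v hv => hW g v hv⟩ with h | h
  · have : W = ⊥ := congrArg Subrepresentation.toSubmodule h
    subst this
    exact absurd ((Submodule.mem_bot ℂ).1 hv) hv0
  · exact congrArg Subrepresentation.toSubmodule h

theorem nontrivial_of_isIrreducible {V : Type*} [AddCommGroup V] [Module ℂ V]
    {ρ : Representation ℂ G V} (hρ : ρ.IsIrreducible) : Nontrivial V := by
  by_contra hV
  rw [not_nontrivial_iff_subsingleton] at hV
  obtain ⟨a, b, hab⟩ := hρ.exists_pair_ne
  exact hab (Subrepresentation.toSubmodule_injective (Subsingleton.elim _ _))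

theorem irr_comp_equiv (e : H ≃* G) {χ : G → ℂ} (hχ : χ ∈ Irr G) : χ ∘ e ∈ Irr H := by
  obtain ⟨n, ρ, hρ, rfl⟩ := hχ
  have := nontrivial_of_isIrreducible hρ
  refine ⟨n, ρ.comp e.toMonoidHom, isIrreducible_of_forall _ fun W hW v hv hv0 => ?_, rfl⟩
  refine eq_top_of_isIrreducible hρ W (fun g v hv => ?_) hv hv0
  simpa using hW (e.symm g) v hv

end Irreducibility

/-! ### Orthogonality of linear characters -/

section LinearCharacters

variable {N : Type*} [Group N]

/-- The character of a one-dimensional representation is a homomorphism. -/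
theorem exists_monoidHom_of_representation {n : ℕ} (hn : n = 1)
    (ρ : Representation ℂ N (Fin n → ℂ)) : ∃ θ : N →* ℂ, ρ.character = θ := by
  subst hn
  -- In dimension one the trace equals the determinant, which is multiplicative.
  refine ⟨LinearMap.det.comp ρ, funext fun g => ?_⟩
  change LinearMap.trace ℂ _ (ρ g) = LinearMap.det (ρ g)
  rw [LinearMap.trace_eq_matrix_trace ℂ (Pi.basisFun ℂ (Fin 1)),
    ← LinearMap.det_toMatrix (Pi.basisFun ℂ (Fin 1)), Matrix.trace_fin_one, Matrix.det_fin_one]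

theorem exists_monoidHom_of_mem_irr (hN : ∀ a b : N, a * b = b * a) {χ : N → ℂ}
    (hχ : χ ∈ Irr N) : ∃ θ : N →* ℂ, χ = θ := by
  obtain ⟨n, ρ, hρ, rfl⟩ := hχ
  have : IsMulCommutative N := ⟨⟨hN⟩⟩
  have h := Representation.IsIrreducible.finrank_eq_one_of_isMulCommutative ρ
  exact exists_monoidHom_of_representation (by simpa using h) ρ

/-- Orthogonality of linear characters. -/
theorem sum_mul_inv [Fintype N] (ψ θ : N →* ℂ) [Decidable (ψ = θ)] :
    ∑ g : N, ψ g * θ g⁻¹ = if ψ = θ then (Nat.card N : ℂ) else 0 := by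
  classical
  let ξ : N →* ℂ :=
    { toFun := fun g => ψ g * θ g⁻¹
      map_one' := by simp
      map_mul' := fun a b => by simp only [mul_inv_rev, map_mul]; ring }
  have hθ (g : N) : θ g⁻¹ * θ g = 1 := by rw [← map_mul, inv_mul_cancel, map_one]
  have hξ : ξ = 1 ↔ ψ = θ := by
    constructor
    · intro h
      ext g
      have hg : ψ g * θ g⁻¹ = 1 := DFunLike.congr_fun h g
      calc ψ g = ψ g * θ g⁻¹ * θ g := by rw [mul_assoc, hθ, mul_one]
        _ = θ g := by rw [hg, one_mul]
    · rintro rfl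
      ext g
      change ψ g * ψ g⁻¹ = 1
      rw [mul_comm, hθ]
  have := sum_hom_units ξ
  simp only [hξ, Nat.card_eq_fintype_card] at this ⊢
  exact this.trans (by split_ifs <;> simp)

variable [Finite N]

theorem conj_monoidHom_apply (θ : N →* ℂ) (g : N) : conj (θ g) = θ g⁻¹ := by
  have h1 : θ g ^ orderOf g = 1 := by rw [← map_pow, pow_orderOf_eq_one, map_one]
  have h2 : ‖θ g‖ = 1 := Complex.norm_eq_one_of_pow_eq_one h1 (orderOf_pos g).ne'
  have h3 : θ g * θ g⁻¹ = 1 := by rw [← map_mul, mul_inv_cancel, map_one]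
  rw [← Complex.inv_eq_conj h2]
  exact inv_eq_of_mul_eq_one_right h3

/-- The scalar product of a sum of distinct linear characters with a linear character. -/
theorem scalarProduct_sum_monoidHom {ι : Type*} [Fintype ι] {ν : ι → N →* ℂ}
    (hν : Function.Injective ν) (θ : N →* ℂ) [Decidable (∃ i, ν i = θ)] :
    scalarProduct (fun g => ∑ i, ν i g) θ = if ∃ i, ν i = θ then 1 else 0 := by
  classical
  have := Fintype.ofFinite N
  have hc : (Nat.card N : ℂ) ≠ 0 := Nat.cast_ne_zero.2 Nat.card_pos.ne'
  have key : ∑ᶠ g : N, (∑ i, ν i g) * conj (θ g) =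
      ∑ i, if ν i = θ then (Nat.card N : ℂ) else 0 := by
    rw [finsum_eq_sum_of_fintype]
    simp only [conj_monoidHom_apply, Finset.sum_mul]
    rw [Finset.sum_comm]
    exact Finset.sum_congr rfl fun i _ => sum_mul_inv _ _
  rw [scalarProduct, key]
  split_ifs with h
  · obtain ⟨i, rfl⟩ := h
    simp [hν.eq_iff]
  · push Not at h
    simp [h]

end LinearCharacters

/-! ### The monomial representation on an orbit -/

section MonomialRepresentation

variable {A G : Type*} [CommGroup A] [Group G] (φ : G →* MulAut A)

/-- The representation of `A ⋊[φ] G` on the functions on a family `ν` of linear characters of `A`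
which is permuted by `G` through `p`. -/
noncomputable def orbitRepresentation {ι : Type*} (ν : ι → A →* ℂ) (p : G → ι → ι)
    (hp : ∀ g i a, ν (p g i) a = ν i (φ g a)) (hν : Function.Injective ν) :
    Representation ℂ (A ⋊[φ] G) (ι → ℂ) where
  toFun x :=
    { toFun := fun f i => ν i x.left * f (p x.right i)
      map_add' := fun f f' => by ext i; simp [mul_add]
      map_smul' := fun c f => by ext i; simp [mul_left_comm] }
  map_one' := by
    have h1 (i : ι) : p 1 i = i := hν (by ext a; simp [hp])
    ext f i
    simp [h1]
  map_mul' x y := by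
    -- Precomposition makes `p` a right action; acting on functions turns it into a left one.
    have hm (g h : G) (i : ι) : p (g * h) i = p h (p g i) := hν (by ext a; simp [hp])
    refine LinearMap.ext fun f => funext fun i => ?_
    simp [hm, hp, mul_assoc]

variable {n : ℕ} {ν : Fin n → A →* ℂ} {p : G → Fin n → Fin n}
  (hp : ∀ g i a, ν (p g i) a = ν i (φ g a)) (hν : Function.Injective ν)

theorem orbitRepresentation_apply (x : A ⋊[φ] G) (f : Fin n → ℂ) (i : Fin n) :
    orbitRepresentation φ ν p hp hν x f i = ν i x.left * f (p x.right i) := rfl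

theorem character_orbitRepresentation_inl (a : A) :
    (orbitRepresentation φ ν p hp hν).character (SemidirectProduct.inl a) = ∑ i, ν i a := by
  have h1 (i : Fin n) : p 1 i = i := hν (by ext a; simp [hp])
  change LinearMap.trace ℂ _ _ = _
  rw [LinearMap.trace_eq_matrix_trace ℂ (Pi.basisFun ℂ (Fin n)), Matrix.trace]
  refine Finset.sum_congr rfl fun i _ => ?_
  simp [orbitRepresentation_apply, h1]

theorem isIrreducible_orbitRepresentation [Finite A] [NeZero n]
    (htrans : ∀ i j, ∃ g, p g i = j) : (orbitRepresentation φ ν p hp hν).IsIrreducible := by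
  classical
  have := Fintype.ofFinite A
  have hc : (Nat.card A : ℂ) ≠ 0 := Nat.cast_ne_zero.2 Nat.card_pos.ne'
  have h1 (i : Fin n) : p 1 i = i := hν (by ext a; simp [hp])
  refine isIrreducible_of_forall _ fun W hW f hf hf0 => ?_
  obtain ⟨j, hj⟩ := Function.ne_iff.1 hf0
  have hsingle : Pi.single j (1 : ℂ) ∈ W := by
    -- Up to the factor `|A|`, this sum is the projection onto the `ν j`-isotypic line.
    have hsum : ∑ a : A, ν j a⁻¹ •
        orbitRepresentation φ ν p hp hν (SemidirectProduct.inl a) f ∈ W :=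
      Submodule.sum_mem _ fun a _ => Submodule.smul_mem _ _ (hW _ _ hf)
    have heq : ∑ a : A, ν j a⁻¹ •
        orbitRepresentation φ ν p hp hν (SemidirectProduct.inl a) f =
        ((Nat.card A : ℂ) * f j) • Pi.single j (1 : ℂ) := by
      ext i
      rw [Finset.sum_apply]
      have (a : A) : (ν j a⁻¹ •
          orbitRepresentation φ ν p hp hν (SemidirectProduct.inl a) f) i =
          (ν i a * ν j a⁻¹) * f i := by
        simp only [Pi.smul_apply, smul_eq_mul, orbitRepresentation_apply,
          SemidirectProduct.left_inl, SemidirectProduct.right_inl, h1]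
        ring
      simp only [this]
      rw [← Finset.sum_mul, sum_mul_inv]
      by_cases hij : i = j
      · subst hij; simp
      · simp [hij, hν.eq_iff]
    rw [heq] at hsum
    exact (Submodule.smul_mem_iff _ (mul_ne_zero hc hj)).1 hsum
  have hall (i : Fin n) : Pi.single i (1 : ℂ) ∈ W := by
    obtain ⟨g, hg⟩ := htrans i j
    -- `p g` is injective since `φ g` is invertible, so `inr g` sends the basis vector at `j` to the
    -- one at `i`.
    have hinj (k : Fin n) : p g k = j ↔ k = i := by
      refine ⟨fun hk => hν ?_, fun hk => hk ▸ hg⟩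
      ext a
      have h := DFunLike.congr_fun (congrArg ν (hk.trans hg.symm)) (φ g⁻¹ a)
      simpa [hp] using h
    have h := hW (SemidirectProduct.inr g) _ hsingle
    convert h using 1
    ext k
    simp [orbitRepresentation_apply, Pi.single_apply, hinj]
  rw [eq_top_iff]
  intro v _
  rw [pi_eq_sum_univ v]
  refine Submodule.sum_mem _ fun i _ => Submodule.smul_mem _ _ ?_
  convert hall i using 1
  ext k
  simp [Pi.single_apply, eq_comm]

end MonomialRepresentation

/-! ### Pseudo-unramifiedness over the normal factor -/

section SemidirectProduct

variable {A G : Type*} [CommGroup A] [Finite A] [Group G] [Finite G] (φ : G →* MulAut A)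

/-- Every linear character of `A` occurs in an irreducible character of `A ⋊[φ] G` whose
restriction to `A` is the sum over the orbit of the linear character. -/
theorem exists_irr_sum_orbit (θ : A →* ℂ) :
    ∃ (n : ℕ) (ν : Fin n → A →* ℂ), Function.Injective ν ∧ (∃ i, ν i = θ) ∧
      ∃ χ ∈ Irr (A ⋊[φ] G), ∀ a, χ (SemidirectProduct.inl a) = ∑ i, ν i a := by
  let F : G → A →* ℂ := fun g => θ.comp (φ g).toMonoidHom
  -- Indexing by the range, not by `G`, lists each character of the orbit once.
  have : Finite (Set.range F) := Set.finite_range F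
  obtain ⟨n, ⟨e⟩⟩ := Finite.exists_equiv_fin (Set.range F)
  let ν : Fin n → A →* ℂ := fun i => (e.symm i).1
  have hν : Function.Injective ν := Subtype.val_injective.comp e.symm.injective
  have hF (g : G) : ν (e ⟨F g, g, rfl⟩) = F g := by simp [ν]
  have hex (g : G) (i : Fin n) : ∃ j, ∀ a, ν j a = ν i (φ g a) := by
    obtain ⟨h, hh⟩ := (e.symm i).2
    refine ⟨e ⟨F (h * g), h * g, rfl⟩, fun a => ?_⟩
    rw [hF]
    change _ = (e.symm i).1 (φ g a)
    rw [← hh]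
    simp [F]
  choose p hp using hex
  have hθ : ν (e ⟨F 1, 1, rfl⟩) = θ := by rw [hF]; ext a; simp [F]
  have : NeZero n := ⟨by rintro rfl; exact (e ⟨F 1, 1, rfl⟩).elim0⟩
  have htrans (i j : Fin n) : ∃ g, p g i = j := by
    obtain ⟨g, hg⟩ := (e.symm i).2
    obtain ⟨h, hh⟩ := (e.symm j).2
    refine ⟨g⁻¹ * h, hν ?_⟩
    ext a
    rw [hp]
    change (e.symm i).1 _ = (e.symm j).1 a
    rw [← hg, ← hh]
    simp [F]
  exact ⟨n, ν, hν, ⟨_, hθ⟩, _, ⟨n, _, isIrreducible_orbitRepresentation φ hp hν htrans, rfl⟩,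
    character_orbitRepresentation_inl φ hp hν⟩

theorem finite_semidirectProduct : Finite (A ⋊[φ] G) :=
  Finite.of_equiv _ (SemidirectProduct.equivProd (φ := φ)).symm

theorem isPseudoUnramifiedOver_range_inl [Nontrivial A] :
    IsPseudoUnramifiedOver (SemidirectProduct.inl : A →* A ⋊[φ] G).range := by
  classical
  have hfin := finite_semidirectProduct φ
  have hcomm : ∀ a ∈ (SemidirectProduct.inl : A →* A ⋊[φ] G).range,
      ∀ b ∈ (SemidirectProduct.inl : A →* A ⋊[φ] G).range, a * b = b * a := by
    rintro _ ⟨a, rfl⟩ _ ⟨b, rfl⟩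
    rw [← map_mul, ← map_mul, mul_comm]
  let e : A ≃* (SemidirectProduct.inl : A →* A ⋊[φ] G).range :=
    MonoidHom.ofInjective SemidirectProduct.inl_injective
  refine ⟨hfin, ?_, ?_, hcomm, fun μ hμ => ?_⟩
  · rw [SemidirectProduct.range_inl_eq_ker_rightHom]
    infer_instance
  · obtain ⟨a, ha⟩ := exists_ne (1 : A)
    intro h
    have : (SemidirectProduct.inl a : A ⋊[φ] G) ∈ (⊥ : Subgroup (A ⋊[φ] G)) := h ▸ ⟨a, rfl⟩
    rw [Subgroup.mem_bot] at this
    exact ha (SemidirectProduct.inl_injective (this.trans (map_one _).symm))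
  · have hN : ∀ a b : (SemidirectProduct.inl : A →* A ⋊[φ] G).range, a * b = b * a :=
      fun a b => Subtype.ext (hcomm a a.2 b b.2)
    obtain ⟨θ, rfl⟩ := exists_monoidHom_of_mem_irr hN hμ.1
    obtain ⟨n, ν, hν, ⟨i, hi⟩, χ, hχ, hχν⟩ :=
      exists_irr_sum_orbit φ (θ.comp e.toMonoidHom)
    let ν' : Fin n → (SemidirectProduct.inl : A →* A ⋊[φ] G).range →* ℂ :=
      fun j => (ν j).comp e.symm.toMonoidHom
    have hν' : Function.Injective ν' := by
      intro j k hjk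
      refine hν (MonoidHom.ext fun a => ?_)
      have := DFunLike.congr_fun hjk (e a)
      simpa [ν'] using this
    have hres : restrict (SemidirectProduct.inl : A →* A ⋊[φ] G).range χ =
        fun x => ∑ j, ν' j x := by
      funext x
      obtain ⟨a, rfl⟩ := e.surjective x
      simpa [ν'] using (show restrict _ χ (e a) = _ from hχν a)
    refine ⟨χ, ⟨hχ, ?_⟩, fun ψ hψ => ?_⟩
    · have : ∃ j, ν' j = θ := ⟨i, by ext x; simp [ν', hi]⟩
      rw [hres, scalarProduct_sum_monoidHom hν', if_pos this]
      exact one_pos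
    · obtain ⟨ψ, rfl⟩ := exists_monoidHom_of_mem_irr hN hψ
      rw [hres, scalarProduct_sum_monoidHom hν']
      split_ifs
      · exact le_rfl
      · exact zero_le_one

end SemidirectProduct

/-! ### Invariance under isomorphism -/

section Transfer

universe v w

theorem scalarProduct_comp_equiv {G H : Type*} (e : H ≃ G) (φ ψ : G → ℂ) :
    scalarProduct (φ ∘ e) (ψ ∘ e) = scalarProduct φ ψ := by
  rw [scalarProduct, scalarProduct, Nat.card_congr e]
  congr 1
  exact finsum_comp_equiv e (f := fun g => φ g * conj (ψ g))

theorem IsPseudoUnramifiedOver.map_equiv {G : Type*} {H : Type*} [Group G] [Group H]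
    {N : Subgroup G} (hN : IsPseudoUnramifiedOver N) (e : G ≃* H) :
    IsPseudoUnramifiedOver (N.map e.toMonoidHom) where
  finite := have := hN.finite; Finite.of_equiv G e.toEquiv
  normal := hN.normal.map _ e.surjective
  nontrivial h := hN.nontrivial ((Subgroup.map_eq_bot_iff_of_injective N e.injective).1 h)
  abelian := by
    rintro _ ⟨a, ha, rfl⟩ _ ⟨b, hb, rfl⟩
    rw [← map_mul, ← map_mul, hN.abelian a ha b hb]
  exists_multiplicityFree μ hμ := by
    let f : N ≃* N.map e.toMonoidHom := e.subgroupMap N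
    obtain ⟨χ, ⟨hχ, hpos⟩, hfree⟩ := hN.exists_multiplicityFree (μ ∘ f)
      ⟨irr_comp_equiv f hμ.1, (congrArg μ (map_one f)).trans hμ.2⟩
    have hres : restrict (N.map e.toMonoidHom) (χ ∘ e.symm) ∘ f = restrict N χ := by
      funext x
      exact congrArg χ (e.symm_apply_apply x)
    refine ⟨χ ∘ e.symm, ⟨irr_comp_equiv e.symm hχ, ?_⟩, fun ψ hψ => ?_⟩
    · rw [← scalarProduct_comp_equiv f.toEquiv]
      exact hres.symm ▸ hpos
    · rw [← scalarProduct_comp_equiv f.toEquiv]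
      exact hres.symm ▸ hfree _ (irr_comp_equiv f hψ)

/-- The quotient by `A` is only isomorphic to `G` and may lie in another universe, hence the
independent `v` and `w`. -/
theorem IsTotallyPseudoUnramified.of_equiv {G : Type v} [Group G]
    (hG : IsTotallyPseudoUnramified G) :
    ∀ {H : Type w} [Group H], G ≃* H → IsTotallyPseudoUnramified H := by
  induction hG with
  | of_abelian G h =>
    intro H _ e
    have : Finite H := Finite.of_equiv G e.toEquiv
    exact .of_abelian H fun a b => e.symm.injective (by rw [map_mul, map_mul, h])
  | of_quotient G N hN _ ih =>
    intro H _ e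
    have hM := hN.map_equiv e
    have := hM.normal
    exact .of_quotient H _ hM (ih (QuotientGroup.congr N _ e rfl))

end Transfer

end PseudoUnramified

open PseudoUnramified in
theorem mainTheorem6 {A : Type*} {G : Type*} [CommGroup A] [Finite A] [Group G] [Finite G]
    (φ : G →* MulAut A) (hG : PseudoUnramified.IsTotallyPseudoUnramified G) :
    (Nontrivial A → PseudoUnramified.IsPseudoUnramifiedOver
      (SemidirectProduct.inl : A →* A ⋊[φ] G).range) ∧
    PseudoUnramified.IsTotallyPseudoUnramified (A ⋊[φ] G) := by
  refine ⟨fun _ => isPseudoUnramifiedOver_range_inl φ, ?_⟩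
  -- A trivial `A` cannot serve as the normal subgroup, but then the product is `G` itself.
  rcases subsingleton_or_nontrivial A with _ | _
  · refine hG.of_equiv (MulEquiv.ofBijective (SemidirectProduct.inr : G →* A ⋊[φ] G)
      ⟨SemidirectProduct.inr_injective, fun x => ⟨x.right, ?_⟩⟩)
    exact SemidirectProduct.ext (Subsingleton.elim _ _) rfl
  · have hA := isPseudoUnramifiedOver_range_inl φ
    have := hA.normal
    refine .of_quotient _ _ hA (hG.of_equiv ?_)
    exact ((QuotientGroup.quotientMulEquivOfEq SemidirectProduct.range_inl_eq_ker_rightHom).trans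
      (QuotientGroup.quotientKerEquivOfSurjective (SemidirectProduct.rightHom (φ := φ))
        SemidirectProduct.rightHom_surjective)).symm
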